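/- Let $n, n_v \ge 1$ be integers and let $A$ be a real symmetric $n \times n$ matrix with eigenvalues $\lambda_1[A], \dots, \lambda_n[A]$ (counted with multiplicity). Let $\Phi[A](x) := \sum_{i=1}^n \frac1n \mathbf 1[\lambda_i[A] \le x]$ be its cumulative empirical spectral measure (CESM), and for a vector $v \in \mathbb R^n$ let $\Psi[A,v](x) := v^{\mathsf T}\, \mathbf 1[A \le x]\, v$ be the weighted CESM, where $\mathbf 1[A \le x]$ is the orthogonal projector onto the span of the eigenvectors of $A$ with eigenvalue at most $x$. Let $v_1, \dots, v_{n_v}$ be independent random vectors, each uniformly distributed on the unit sphere $\mathcal S^{n-1} \subset \mathbb R^n$; set $\Psi_i := \Psi[A, v_i]$ and $\langle \Psi_i(x) \rangle := \frac{1}{n_v} \sum_{i=1}^{n_v} \Psi_i(x)$. For $\mu, \nu : \mathbb R \to [0,1]$ let $d_{\mathrm{KS}}(\mu,\nu) := \sup_{x \in \mathbb R} |\mu(x) - \nu(x)|$. Then, for all $x \in \mathbb R$ and $t > 0$, $$\mathbb P\big[\, |\Phi[A](x) - \langle \Psi_i(x) \rangle| > t \,\big] \le 2 \exp\left( - n_v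 (n+2) t^2 \right),$$ $$\mathbb P\big[\, d_{\mathrm{KS}}(\Phi[A], \langle \Psi_i \rangle) > t \,\big] \le 2 n \exp\left( - n_v (n+2) t^2 \right).$$ -/

import Mathlib

open MeasureTheory ProbabilityTheory

noncomputable section

/-- The cumulative empirical spectral measure `Φ[A](x) = ∑ i, (1/n) 𝟙[λ_i(A) ≤ x]` of a real
symmetric `n × n` matrix; `hA.eigenvalues` lists the eigenvalues with multiplicity. -/
def cesm {n : ℕ} {A : Matrix (Fin n) (Fin n) ℝ} (hA : A.IsHermitian) (x : ℝ) : ℝ :=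
  ∑ i : Fin n, (1 / (n : ℝ)) * (if hA.eigenvalues i ≤ x then 1 else 0)

/-- The matrix function `f[A] = U f[Λ] Uᵀ`, where `A = U Λ Uᵀ` is an orthogonal
diagonalization of the real symmetric matrix `A`. -/
def matrixFunction {n : ℕ} {A : Matrix (Fin n) (Fin n) ℝ} (hA : A.IsHermitian) (f : ℝ → ℝ) :
    Matrix (Fin n) (Fin n) ℝ :=
  (hA.eigenvectorUnitary : Matrix (Fin n) (Fin n) ℝ) *
    Matrix.diagonal (fun i => f (hA.eigenvalues i)) *
    (hA.eigenvectorUnitary : Matrix (Fin n) (Fin n) ℝ).transpose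

/-- `𝟙[A ≤ x]`: the matrix function of `A` for the indicator of `(-∞, x]`, that is, the orthogonal
projector onto the span of the eigenvectors of `A` whose eigenvalue is at most `x`. -/
def spectralProjector {n : ℕ} {A : Matrix (Fin n) (Fin n) ℝ} (hA : A.IsHermitian) (x : ℝ) :
    Matrix (Fin n) (Fin n) ℝ :=
  matrixFunction hA (fun s => if s ≤ x then 1 else 0)

/-- The weighted CESM `Ψ[A, v](x) = vᵀ 𝟙[A ≤ x] v`. -/
def weightedCesm {n : ℕ} {A : Matrix (Fin n) (Fin n) ℝ} (hA : A.IsHermitian)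
    (v : EuclideanSpace ℝ (Fin n)) (x : ℝ) : ℝ :=
  v.ofLp ⬝ᵥ ((spectralProjector hA x).mulVec v.ofLp)

/-- The sample average `⟨x_i⟩ = (1/m) ∑ i, x_i`. -/
def sampleAverage {m : ℕ} (x : Fin m → ℝ) : ℝ :=
  (1 / (m : ℝ)) * ∑ i, x i

/-- The Kolmogorov–Smirnov distance `sup_x |μ(x) - ν(x)|` of two distribution functions. The
supremum is over a bounded set whenever `μ` and `ν` are bounded functions, as they are for
distribution functions. -/
def ksDist (μ ν : ℝ → ℝ) : ℝ :=
  ⨆ x : ℝ, |μ x - ν x|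

/-- The uniform distribution on the unit sphere of `ℝⁿ`: the surface measure induced by Lebesgue
measure, divided by its total mass. -/
def uniformSphere (n : ℕ) : Measure (Metric.sphere (0 : EuclideanSpace ℝ (Fin n)) 1) :=
  ((volume : Measure (EuclideanSpace ℝ (Fin n))).toSphere Set.univ)⁻¹ •
    (volume : Measure (EuclideanSpace ℝ (Fin n))).toSphere

end

/-! ### Optimal sub-Gaussian bound from the Beta moment recursion. -/

section BetaMoments

variable {Ω : Type*} [MeasurableSpace Ω] {μ : Measure Ω} [IsProbabilityMeasure μ] {X : Ω → ℝ}

/-! With `S` the set of indices whose eigenvalue is at most `x`, the weighted CESM at `x` is the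
squared norm of the projection of `v` onto a `#S`-dimensional subspace, and the CESM `#S / n` is its
mean. The pointwise bound is then Chernoff's inequality for independent variables with variance
proxy `1 / (2 * (n + 2))` (`hasSubgaussianMGF_projNormSq`). The uniform bound is a union bound,
since only the `n` eigenvalues matter as thresholds.

The proxy uses nothing but the Beta moment recursion `toSphere_moment_succ`, which follows from
Gaussian integration by parts and polar coordinates. Summed against `s ^ p / p!`, the recursion
becomes a Stein identity, that is, a Riccati equation `s g' = α - c g + s g (1 - g)` for the
logarithmic derivative `g` of the moment-generating function. Since `g (1 - g) ≤ 1 / 4`, comparison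
with the linear equation `s h' = α - c h + s / 4`, solved by `h = α / c + s / (4 (c + 1))`, bounds
`g` for `s ≥ 0`. Passing to the complement of `S` covers `s ≤ 0`. -/

lemma integrable_pow_mul_exp_of_mem_Icc (hX : AEMeasurable X μ)
    (hX01 : ∀ ω, X ω ∈ Set.Icc (0 : ℝ) 1) (k : ℕ) (s : ℝ) :
    Integrable (fun ω ↦ X ω ^ k * Real.exp (s * X ω)) μ := by
  refine Integrable.of_bound (C := Real.exp |s|) (by fun_prop) (ae_of_all _ fun ω ↦ ?_)
  obtain ⟨h0, h1⟩ := hX01 ω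
  rw [Real.norm_of_nonneg (by positivity)]
  have hle : s * X ω ≤ |s| := by
    calc s * X ω ≤ |s| * X ω := by gcongr; exact le_abs_self s
      _ ≤ |s| := mul_le_of_le_one_right (abs_nonneg s) h1
  calc X ω ^ k * Real.exp (s * X ω) ≤ 1 * Real.exp |s| := by
        gcongr
        exact pow_le_one₀ h0 h1
    _ = _ := one_mul _

lemma integrableExpSet_eq_univ_of_mem_Icc (hX : AEMeasurable X μ)
    (hX01 : ∀ ω, X ω ∈ Set.Icc (0 : ℝ) 1) : integrableExpSet X μ = Set.univ := by
  ext t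
  simpa [integrableExpSet] using integrable_pow_mul_exp_of_mem_Icc hX hX01 0 t

lemma hasSum_integral_pow_mul_exp (hX : AEMeasurable X μ)
    (hX01 : ∀ ω, X ω ∈ Set.Icc (0 : ℝ) 1) (k : ℕ) (s : ℝ) :
    HasSum (fun p : ℕ ↦ s ^ p / p.factorial * ∫ ω, X ω ^ (p + k) ∂μ)
      (∫ ω, X ω ^ k * Real.exp (s * X ω) ∂μ) := by
  have hbound (p : ℕ) (ω : Ω) :
      ‖s ^ p / p.factorial * X ω ^ (p + k)‖ ≤ |s| ^ p / p.factorial := by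
    obtain ⟨h0, h1⟩ := hX01 ω
    rw [norm_mul, norm_div, norm_pow, Real.norm_eq_abs, Real.norm_natCast,
      Real.norm_of_nonneg (by positivity)]
    exact mul_le_of_le_one_right (by positivity) (pow_le_one₀ h0 h1)
  have hint (p : ℕ) : Integrable (fun ω ↦ s ^ p / p.factorial * X ω ^ (p + k)) μ :=
    Integrable.of_bound (C := |s| ^ p / p.factorial) (by fun_prop)
      (ae_of_all _ (hbound p))
  have hsum : Summable fun p : ℕ ↦ ∫ ω, ‖s ^ p / p.factorial * X ω ^ (p + k)‖ ∂μ := by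
    refine Summable.of_nonneg_of_le (fun p ↦ integral_nonneg fun ω ↦ norm_nonneg _) (fun p ↦ ?_)
      (Real.summable_pow_div_factorial |s|)
    calc ∫ ω, ‖s ^ p / p.factorial * X ω ^ (p + k)‖ ∂μ
        ≤ ∫ _, |s| ^ p / p.factorial ∂μ :=
          integral_mono (hint p).norm (integrable_const _) (hbound p)
      _ = _ := by simp
  have h := hasSum_integral_of_summable_integral_norm hint hsum
  simp only [integral_const_mul] at h
  have hω (ω : Ω) : X ω ^ k * Real.exp (s * X ω)
      = ∑' p : ℕ, s ^ p / p.factorial * X ω ^ (p + k) := by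
    have he : HasSum (fun p : ℕ ↦ (s * X ω) ^ p / p.factorial) (Real.exp (s * X ω)) := by
      rw [Real.exp_eq_exp_ℝ]
      exact NormedSpace.expSeries_div_hasSum_exp _
    rw [← he.tsum_eq]
    rw [← tsum_mul_left]
    refine tsum_congr fun p ↦ ?_
    ring
  simp only [hω]
  exact h

/-- The Stein identity for a random variable with the moments of a Beta distribution,
tested against exponentials. -/
lemma stein_identity_of_moments (hX : AEMeasurable X μ) (hX01 : ∀ ω, X ω ∈ Set.Icc (0 : ℝ) 1)
    {α c : ℝ} (hmom : ∀ p : ℕ, (c + p) * ∫ ω, X ω ^ (p + 1) ∂μ = (α + p) * ∫ ω, X ω ^ p ∂μ)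
    (s : ℝ) :
    α * ∫ ω, X ω ^ 0 * Real.exp (s * X ω) ∂μ - c * ∫ ω, X ω ^ 1 * Real.exp (s * X ω) ∂μ
      + s * ((∫ ω, X ω ^ 1 * Real.exp (s * X ω) ∂μ)
        - ∫ ω, X ω ^ 2 * Real.exp (s * X ω) ∂μ) = 0 := by
  have hs := fun k ↦ hasSum_integral_pow_mul_exp hX hX01 k s
  have hshift (k : ℕ) : HasSum (fun p : ℕ ↦ p * (s ^ p / p.factorial * ∫ ω, X ω ^ (p + k) ∂μ))
      (s * ∫ ω, X ω ^ (k + 1) * Real.exp (s * X ω) ∂μ) := by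
    -- The factor `p` kills the term `p = 0`; shifting the index turns `p / p!` into `1 / (p - 1)!`
    -- and releases one factor `s`.
    rw [← hasSum_nat_add_iff' 1]
    convert! (hs (k + 1)).mul_left s using 1
    · ext p
      rw [Nat.factorial_succ, add_assoc p 1 k, add_comm 1 k]
      push_cast
      have : (p.factorial : ℝ) ≠ 0 := by positivity
      field_simp
      ring
    · simp
  have h := (((hs 0).mul_left α).sub ((hs 1).mul_left c)).add ((hshift 0).sub (hshift 1))
  rw [mul_sub]
  refine h.unique ?_
  convert hasSum_zero using 1
  -- The coefficient of `s ^ p / p!` is `(α + p) m_p - (c + p) m_{p+1}`, where `m_p` is the `p`-th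
  -- moment.
  ext p
  linear_combination (-(s ^ p / p.factorial)) * hmom p

/-- The optimal Riccati bound: the logarithmic derivative of the moment-generating function of a
variable with Beta moments is at most that of a Gaussian with variance `1 / (4 * (c + 1))`. -/
lemma integral_mul_exp_le_of_moments (hX : AEMeasurable X μ)
    (hX01 : ∀ ω, X ω ∈ Set.Icc (0 : ℝ) 1) {α c : ℝ} (hc : 0 < c)
    (hmom : ∀ p : ℕ, (c + p) * ∫ ω, X ω ^ (p + 1) ∂μ = (α + p) * ∫ ω, X ω ^ p ∂μ)
    {s : ℝ} (hs : 0 ≤ s) :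
    ∫ ω, X ω * Real.exp (s * X ω) ∂μ ≤ (α / c + s / (4 * (c + 1))) * mgf X μ s := by
  set J : ℕ → ℝ → ℝ := fun k s ↦ ∫ ω, X ω ^ k * Real.exp (s * X ω) ∂μ with hJ
  have hint : ∀ t, t ∈ interior (integrableExpSet X μ) := by
    simp [integrableExpSet_eq_univ_of_mem_Icc hX hX01]
  have hderiv (k : ℕ) (t : ℝ) : HasDerivAt (J k) (J (k + 1) t) t :=
    hasDerivAt_integral_pow_mul_exp_real (hint t) k
  have hJ0 : J 0 = mgf X μ := by ext t; simp [hJ, mgf]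
  have hJ1 : J 1 s = ∫ ω, X ω * Real.exp (s * X ω) ∂μ := by simp [hJ]
  have hpos (t : ℝ) : 0 < J 0 t := by
    rw [hJ0]
    exact mgf_pos (interior_subset (s := integrableExpSet X μ) (hint t))
  have hstein (t : ℝ) : α * J 0 t - c * J 1 t + t * (J 1 t - J 2 t) = 0 :=
    stein_identity_of_moments hX hX01 hmom t
  rw [← hJ0, ← hJ1, ← div_le_iff₀ (hpos s)]
  have hg (t : ℝ) : HasDerivAt (fun t ↦ J 1 t / J 0 t)
      ((J 2 t * J 0 t - J 1 t * J 1 t) / J 0 t ^ 2) t :=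
    (hderiv 1 t).div (hderiv 0 t) (hpos t).ne'
  -- `t ^ c` is the integrating factor of the linear comparison equation.
  set w : ℝ → ℝ := fun t ↦ t ^ c * (J 1 t / J 0 t - (α / c + t / (4 * (c + 1)))) with hw
  have hwd {t : ℝ} (ht : 0 < t) : HasDerivAt w (c * t ^ (c - 1) *
      (J 1 t / J 0 t - (α / c + t / (4 * (c + 1)))) +
      t ^ c * ((J 2 t * J 0 t - J 1 t * J 1 t) / J 0 t ^ 2 - 1 / (4 * (c + 1)))) t := by
    refine (Real.hasDerivAt_rpow_const (Or.inl ht.ne')).mul ((hg t).sub ?_)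
    exact ((hasDerivAt_id t).div_const _).const_add _
  have hwcont : ContinuousOn w (Set.Ici 0) := by
    refine ContinuousOn.mul (fun t ht ↦ ?_) (fun t ht ↦ ?_)
    · exact (Real.continuousAt_rpow_const t c (Or.inr hc.le)).continuousWithinAt
    · exact ((hg t).continuousAt.sub (by fun_prop)).continuousWithinAt
  have hanti : AntitoneOn w (Set.Ici 0) := by
    refine antitoneOn_of_deriv_nonpos (convex_Ici 0) hwcont ?_ ?_
    · rw [interior_Ici]
      exact fun t ht ↦ (hwd ht).differentiableAt.differentiableWithinAt
    · rw [interior_Ici]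
      intro t ht
      have ht0 : 0 < t := ht
      rw [(hwd ht0).deriv]
      have hrp : t ^ c = t ^ (c - 1) * t := by
        rw [Real.rpow_sub_one ht0.ne', div_mul_cancel₀ _ ht0.ne']
      have h2 : t * (J 2 t / J 0 t) = α - c * (J 1 t / J 0 t) + t * (J 1 t / J 0 t) := by
        have := (hpos t).ne'
        field_simp
        linear_combination - hstein t
      have h3 : (J 2 t * J 0 t - J 1 t * J 1 t) / J 0 t ^ 2
          = J 2 t / J 0 t - (J 1 t / J 0 t) ^ 2 := by
        have := (hpos t).ne'
        field_simp
      rw [h3, hrp]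
      set g := J 1 t / J 0 t
      -- Completing the square: `g - g ^ 2 = 1 / 4 - (g - 1 / 2) ^ 2`.
      have key : c * t ^ (c - 1) * (g - (α / c + t / (4 * (c + 1)))) +
          t ^ (c - 1) * t * (J 2 t / J 0 t - g ^ 2 - 1 / (4 * (c + 1)))
          = - (t ^ (c - 1) * t * (g - 1 / 2) ^ 2) := by
        have e : c * (g - (α / c + t / (4 * (c + 1)))) + t * (J 2 t / J 0 t)
            - t * g ^ 2 - t / (4 * (c + 1)) = - (t * (g - 1 / 2) ^ 2) := by
          rw [h2]
          field_simp
          ring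
        linear_combination t ^ (c - 1) * e
      rw [key, neg_nonpos]
      positivity
  -- At `s = 0` the weight `s ^ c` vanishes and `w` carries no information; the Stein identity gives
  -- equality there.
  rcases hs.eq_or_lt with rfl | hs'
  · have h := hstein 0
    have := (hpos 0).ne'
    have : J 1 0 / J 0 0 = α / c := by
      field_simp
      linarith
    simp [this]
  · have h := hanti (Set.mem_Ici.2 le_rfl) (Set.mem_Ici.2 hs) hs
    simp only [hw, Real.zero_rpow hc.ne', zero_mul] at h
    have hp : 0 < s ^ c := Real.rpow_pos_of_pos hs' c
    have := nonpos_of_mul_nonpos_right h hp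
    linarith

/-- Integrates the bound on the logarithmic derivative from `0` to `s`: the quotient of the two
sides is antitone and equals `1` at `0`. -/
lemma mgf_le_of_moments_of_nonneg (hX : AEMeasurable X μ)
    (hX01 : ∀ ω, X ω ∈ Set.Icc (0 : ℝ) 1) {α c : ℝ} (hc : 0 < c)
    (hmom : ∀ p : ℕ, (c + p) * ∫ ω, X ω ^ (p + 1) ∂μ = (α + p) * ∫ ω, X ω ^ p ∂μ)
    {s : ℝ} (hs : 0 ≤ s) :
    mgf X μ s ≤ Real.exp (s * (α / c) + s ^ 2 / (8 * (c + 1))) := by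
  have hint : ∀ t, t ∈ interior (integrableExpSet X μ) := by
    simp [integrableExpSet_eq_univ_of_mem_Icc hX hX01]
  set b : ℝ → ℝ := fun t ↦ t * (α / c) + t ^ 2 / (8 * (c + 1)) with hb
  have hd (t : ℝ) : HasDerivAt (fun t ↦ mgf X μ t * Real.exp (-b t))
      ((∫ ω, X ω * Real.exp (t * X ω) ∂μ) * Real.exp (-b t) +
        mgf X μ t * (Real.exp (-b t) * -(α / c + t / (4 * (c + 1))))) t := by
    refine (hasDerivAt_mgf (hint t)).mul (HasDerivAt.exp (HasDerivAt.neg ?_))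
    convert! ((hasDerivAt_id t).mul_const (α / c)).add
      (((hasDerivAt_id t).pow 2).div_const (8 * (c + 1))) using 1
    simp only [id, Nat.cast_ofNat]
    field_simp
    ring
  have hanti : AntitoneOn (fun t ↦ mgf X μ t * Real.exp (-b t)) (Set.Ici 0) := by
    refine antitoneOn_of_deriv_nonpos (convex_Ici 0)
      (fun t _ ↦ (hd t).continuousAt.continuousWithinAt)
      (fun t _ ↦ (hd t).differentiableAt.differentiableWithinAt) fun t ht ↦ ?_
    rw [(hd t).deriv]
    have h := mul_le_mul_of_nonneg_right
      (integral_mul_exp_le_of_moments hX hX01 hc hmom (interior_subset ht))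
      (Real.exp_pos (-b t)).le
    linarith
  have h := hanti (Set.mem_Ici.2 le_rfl) (Set.mem_Ici.2 hs) hs
  simp only [mgf_zero, hb] at h
  rw [Real.exp_neg, ← div_eq_mul_inv, div_le_iff₀ (Real.exp_pos _)] at h
  simpa using h

end BetaMoments

/-! ### Gaussian integration by parts and moments on the sphere. -/

section GaussianMoments

variable {E : Type*} [NormedAddCommGroup E] [InnerProductSpace ℝ E]
  {ι : Type*} [Fintype ι]

open scoped RealInnerProductSpace

/-- The squared norm of the orthogonal projection of `x` onto the span of the vectors `b i`,
`i ∈ S`. -/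
noncomputable def projNormSq (b : OrthonormalBasis ι ℝ E) (S : Finset ι) (x : E) : ℝ :=
  ∑ i ∈ S, ⟪b i, x⟫ ^ 2

variable (b : OrthonormalBasis ι ℝ E) (S : Finset ι)

lemma projNormSq_nonneg (x : E) : 0 ≤ projNormSq b S x :=
  Finset.sum_nonneg fun _ _ ↦ sq_nonneg _

lemma projNormSq_univ (x : E) : projNormSq b Finset.univ x = ‖x‖ ^ 2 := by
  simpa [projNormSq] using b.sum_sq_norm_inner_right x

lemma projNormSq_add_compl [DecidableEq ι] (x : E) :
    projNormSq b S x + projNormSq b Sᶜ x = ‖x‖ ^ 2 := by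
  rw [← projNormSq_univ b x]
  exact Finset.sum_add_sum_compl S _

lemma projNormSq_le (x : E) : projNormSq b S x ≤ ‖x‖ ^ 2 := by
  rw [← projNormSq_univ b x]
  exact Finset.sum_le_sum_of_subset_of_nonneg (Finset.subset_univ S) fun _ _ _ ↦ sq_nonneg _

lemma abs_projNormSq_pow_le (m : ℕ) (x : E) : |projNormSq b S x ^ m| ≤ ‖x‖ ^ (2 * m) := by
  rw [abs_of_nonneg (pow_nonneg (projNormSq_nonneg b S x) m), pow_mul]
  exact pow_le_pow_left₀ (projNormSq_nonneg b S x) (projNormSq_le b S x) m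

@[fun_prop]
lemma continuous_projNormSq : Continuous (projNormSq b S) := by
  unfold projNormSq
  fun_prop

lemma projNormSq_smul (r : ℝ) (x : E) :
    projNormSq b S (r • x) = r ^ 2 * projNormSq b S x := by
  simp only [projNormSq, Finset.mul_sum, real_inner_smul_right, mul_pow]

lemma abs_inner_basis_le (i : ι) (x : E) : |⟪b i, x⟫| ≤ ‖x‖ := by
  simpa using abs_real_inner_le_norm (b i) x

variable {S}

lemma hasLineDerivAt_projNormSq {i : ι} (hi : i ∈ S) (x : E) :
    HasLineDerivAt ℝ (projNormSq b S) (2 * ⟪b i, x⟫) x (b i) := by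
  classical
  have h (j : ι) : HasDerivAt (fun t : ℝ ↦ ⟪b j, x + t • b i⟫ ^ 2)
      (if j = i then 2 * ⟪b i, x⟫ else 0) 0 := by
    have h1 : HasDerivAt (fun t : ℝ ↦ ⟪b j, x⟫ + t * ⟪b j, b i⟫) ⟪b j, b i⟫ 0 := by
      simpa using! ((hasDerivAt_id (0 : ℝ)).mul_const ⟪b j, b i⟫).const_add ⟪b j, x⟫
    simp only [inner_add_right, real_inner_smul_right]
    convert! h1.pow 2 using 1
    rw [orthonormal_iff_ite.1 b.orthonormal j i]
    split_ifs with hji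
    · subst hji
      simp
    · simp
  have hs := HasDerivAt.fun_sum (u := S) fun j _ ↦ h j
  rw [Finset.sum_ite_eq' S i, if_pos hi] at hs
  exact hs

lemma hasLineDerivAt_exp_neg_norm_sq (x v : E) :
    HasLineDerivAt ℝ (fun x : E ↦ Real.exp (-‖x‖ ^ 2 / 2))
      (-⟪v, x⟫ * Real.exp (-‖x‖ ^ 2 / 2)) x v := by
  have h : HasDerivAt (fun t : ℝ ↦ ‖x + t • v‖ ^ 2) (2 * ⟪v, x⟫) 0 := by
    have h1 : HasDerivAt (fun t : ℝ ↦ ‖x‖ ^ 2 + t * (2 * ⟪v, x⟫) + t ^ 2 * ‖v‖ ^ 2)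
        (2 * ⟪v, x⟫) 0 := by
      simpa using! (((hasDerivAt_id (0 : ℝ)).mul_const (2 * ⟪v, x⟫)).const_add (‖x‖ ^ 2)).add
        (((hasDerivAt_id (0 : ℝ)).pow 2).mul_const (‖v‖ ^ 2))
    refine h1.congr_of_eventuallyEq (Filter.Eventually.of_forall fun t ↦ ?_)
    simp only [norm_add_sq_real, real_inner_smul_right, norm_smul, mul_pow, real_inner_comm x v,
      Real.norm_eq_abs, sq_abs]
    ring
  refine (h.neg.div_const 2).exp.congr_deriv ?_
  simp
  ring

variable [FiniteDimensional ℝ E] [MeasurableSpace E] [BorelSpace E]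

lemma integrable_mul_exp_neg_norm_sq [Nontrivial E] (μ : Measure E) [μ.IsAddHaarMeasure]
    {f : E → ℝ} (hf : Continuous f)
    {C : ℝ} {k : ℕ} (hbound : ∀ x, |f x| ≤ C * ‖x‖ ^ k) :
    Integrable (fun x ↦ f x * Real.exp (-‖x‖ ^ 2 / 2)) μ := by
  have h : Integrable (fun x : E ↦ ‖x‖ ^ k * Real.exp (-‖x‖ ^ 2 / 2)) μ := by
    rw [integrable_fun_norm_addHaar μ (f := fun r ↦ r ^ k * Real.exp (-r ^ 2 / 2))]
    refine (integrableOn_rpow_mul_exp_neg_mul_sq (b := 1 / 2) (by norm_num)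
      (s := ((Module.finrank ℝ E - 1 + k : ℕ) : ℝ)) ?_).congr_fun (fun r _ ↦ ?_)
        measurableSet_Ioi
    · have : (0 : ℝ) ≤ ((Module.finrank ℝ E - 1 + k : ℕ) : ℝ) := Nat.cast_nonneg _
      linarith
    · simp only [Real.rpow_natCast, smul_eq_mul, pow_add]
      rw [mul_assoc]
      congr 3
      ring
  refine (h.const_mul C).mono' (by fun_prop) (ae_of_all _ fun x ↦ ?_)
  rw [norm_mul, Real.norm_eq_abs, Real.norm_of_nonneg (Real.exp_pos _).le, ← mul_assoc]
  gcongr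
  exact hbound x

/-- Integration by parts in direction `b i`: one factor `⟪b i, x⟫` is absorbed in the derivative of
the Gaussian weight. -/
lemma integral_inner_sq_mul_projNormSq_pow [Nontrivial E] (μ : Measure E) [μ.IsAddHaarMeasure]
    {i : ι} (hi : i ∈ S) (p : ℕ) :
    ∫ x, ⟪b i, x⟫ ^ 2 * projNormSq b S x ^ p * Real.exp (-‖x‖ ^ 2 / 2) ∂μ
      = ∫ x, (projNormSq b S x ^ p + 2 * p * projNormSq b S x ^ (p - 1) * ⟪b i, x⟫ ^ 2)
          * Real.exp (-‖x‖ ^ 2 / 2) ∂μ := by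
  have hf (x : E) : HasLineDerivAt ℝ (fun x ↦ ⟪b i, x⟫ * projNormSq b S x ^ p)
      (projNormSq b S x ^ p + 2 * p * projNormSq b S x ^ (p - 1) * ⟪b i, x⟫ ^ 2) x (b i) := by
    have h1 : HasDerivAt (fun t : ℝ ↦ ⟪b i, x + t • b i⟫) 1 0 := by
      simp only [inner_add_right, real_inner_smul_right]
      simpa using! ((hasDerivAt_id (0 : ℝ)).mul_const ⟪b i, b i⟫).const_add ⟪b i, x⟫
    have h2 : HasDerivAt (fun t : ℝ ↦ projNormSq b S (x + t • b i)) (2 * ⟪b i, x⟫) 0 :=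
      hasLineDerivAt_projNormSq b hi x
    refine (h1.mul (h2.pow p)).congr_deriv ?_
    simp
    ring
  have hterm : Integrable (fun x ↦ (projNormSq b S x ^ p) * Real.exp (-‖x‖ ^ 2 / 2)) μ :=
    integrable_mul_exp_neg_norm_sq μ (by fun_prop) (C := 1) (k := 2 * p) fun x ↦ by
      simpa using abs_projNormSq_pow_le b S p x
  have hterm2 : Integrable (fun x ↦ (2 * p * projNormSq b S x ^ (p - 1) * ⟪b i, x⟫ ^ 2)
      * Real.exp (-‖x‖ ^ 2 / 2)) μ :=
    integrable_mul_exp_neg_norm_sq μ (by fun_prop) (C := 2 * p) (k := 2 * (p - 1) + 2)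
      fun x ↦ by
        rw [abs_mul, abs_mul, abs_of_nonneg (by positivity : (0 : ℝ) ≤ 2 * p), abs_pow,
          mul_assoc, pow_add]
        gcongr
        · rw [← abs_pow]; exact abs_projNormSq_pow_le b S _ x
        · rw [abs_pow]; gcongr; exact abs_inner_basis_le b i x
  have h := integral_bilinear_hasLineDerivAt_right_eq_neg_left_of_integrable (μ := μ)
    (B := ContinuousLinearMap.mul ℝ ℝ) (v := b i)
    (f := fun x ↦ ⟪b i, x⟫ * projNormSq b S x ^ p)
    (f' := fun x ↦ projNormSq b S x ^ p + 2 * p * projNormSq b S x ^ (p - 1) * ⟪b i, x⟫ ^ 2)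
    (g := fun x ↦ Real.exp (-‖x‖ ^ 2 / 2))
    (g' := fun x ↦ -⟪b i, x⟫ * Real.exp (-‖x‖ ^ 2 / 2))
    ?_ ?_ ?_ (fun x _ ↦ hf x) (fun x _ ↦ hasLineDerivAt_exp_neg_norm_sq x (b i))
  · simp only [ContinuousLinearMap.mul_apply'] at h
    rw [← neg_inj, ← h, ← integral_neg]
    congr 1 with x
    ring
  · simp only [ContinuousLinearMap.mul_apply', add_mul]
    exact hterm.add hterm2
  · have := integrable_mul_exp_neg_norm_sq μ (f := fun x ↦ -(⟪b i, x⟫ ^ 2 * projNormSq b S x ^ p))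
      (by fun_prop) (C := 1) (k := 2 + 2 * p) fun x ↦ by
        rw [abs_neg, abs_mul, one_mul, pow_add]
        gcongr
        · rw [abs_pow]; gcongr; exact abs_inner_basis_le b i x
        · exact abs_projNormSq_pow_le b S p x
    refine this.congr (ae_of_all _ fun x ↦ ?_)
    simp only [ContinuousLinearMap.mul_apply']
    ring
  · refine integrable_mul_exp_neg_norm_sq μ (by fun_prop) (C := 1) (k := 1 + 2 * p) fun x ↦ ?_
    rw [abs_mul, one_mul, pow_add, pow_one]
    gcongr
    · exact abs_inner_basis_le b i x
    · exact abs_projNormSq_pow_le b S p x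

variable (S)

lemma integrable_projNormSq_pow [Nontrivial E] (μ : Measure E) [μ.IsAddHaarMeasure] (p : ℕ) :
    Integrable (fun x ↦ projNormSq b S x ^ p * Real.exp (-‖x‖ ^ 2 / 2)) μ := by
  refine integrable_mul_exp_neg_norm_sq μ (by fun_prop) (C := 1) (k := 2 * p) fun x ↦ ?_
  rw [one_mul]
  exact abs_projNormSq_pow_le b S p x

/-- The moment recursion of the chi-squared distribution with `#S` degrees of freedom. -/
lemma integral_projNormSq_pow_succ [Nontrivial E] (μ : Measure E) [μ.IsAddHaarMeasure] (p : ℕ) :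
    ∫ x, projNormSq b S x ^ (p + 1) * Real.exp (-‖x‖ ^ 2 / 2) ∂μ
      = (S.card + 2 * p) * ∫ x, projNormSq b S x ^ p * Real.exp (-‖x‖ ^ 2 / 2) ∂μ := by
  have hint (i : ι) (m : ℕ) : Integrable (fun x ↦ ⟪b i, x⟫ ^ 2 * projNormSq b S x ^ m
      * Real.exp (-‖x‖ ^ 2 / 2)) μ :=
    integrable_mul_exp_neg_norm_sq μ (by fun_prop) (C := 1) (k := 2 + 2 * m) fun x ↦ by
      rw [abs_mul, one_mul, pow_add]
      gcongr
      · rw [abs_pow]; gcongr; exact abs_inner_basis_le b i x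
      · exact abs_projNormSq_pow_le b S m x
  have hint2 (i : ι) : Integrable (fun x ↦ (projNormSq b S x ^ p
      + 2 * p * projNormSq b S x ^ (p - 1) * ⟪b i, x⟫ ^ 2) * Real.exp (-‖x‖ ^ 2 / 2)) μ := by
    refine ((integrable_projNormSq_pow b S μ p).add ((hint i (p - 1)).const_mul (2 * p))).congr
      (ae_of_all _ fun x ↦ ?_)
    simp only [Pi.add_apply]
    ring
  calc ∫ x, projNormSq b S x ^ (p + 1) * Real.exp (-‖x‖ ^ 2 / 2) ∂μ
      = ∫ x, ∑ i ∈ S, ⟪b i, x⟫ ^ 2 * projNormSq b S x ^ p * Real.exp (-‖x‖ ^ 2 / 2) ∂μ := by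
        congr 1 with x
        rw [← Finset.sum_mul, ← Finset.sum_mul, pow_succ', projNormSq]
    _ = ∑ i ∈ S, ∫ x, (projNormSq b S x ^ p
          + 2 * p * projNormSq b S x ^ (p - 1) * ⟪b i, x⟫ ^ 2) * Real.exp (-‖x‖ ^ 2 / 2) ∂μ := by
        rw [integral_finsetSum S fun i _ ↦ hint i p]
        exact Finset.sum_congr rfl fun i hi ↦ integral_inner_sq_mul_projNormSq_pow b μ hi p
    _ = ∫ x, (S.card + 2 * p) * (projNormSq b S x ^ p * Real.exp (-‖x‖ ^ 2 / 2)) ∂μ := by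
        rw [← integral_finsetSum S fun i _ ↦ hint2 i]
        congr 1 with x
        -- The factor `p` makes the truncated exponent `p - 1` harmless at `p = 0`.
        have hp : (p : ℝ) * projNormSq b S x ^ (p - 1) * projNormSq b S x
            = p * projNormSq b S x ^ p := by
          rcases p with _ | p
          · simp
          · rw [Nat.add_sub_cancel, mul_assoc, ← pow_succ]
        rw [← Finset.sum_mul, Finset.sum_add_distrib, ← Finset.mul_sum, Finset.sum_const,
          nsmul_eq_mul, ← projNormSq]
        linear_combination 2 * Real.exp (-‖x‖ ^ 2 / 2) * hp
    _ = _ := integral_const_mul _ _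

/-- Polar coordinates. -/
lemma integral_projNormSq_pow_eq_mul_toSphere [Nontrivial E] (μ : Measure E)
    [μ.IsAddHaarMeasure] (p : ℕ) :
    ∫ x, projNormSq b S x ^ p * Real.exp (-‖x‖ ^ 2 / 2) ∂μ
      = (∫ u : Metric.sphere (0 : E) 1, projNormSq b S u ^ p ∂μ.toSphere) *
        ∫ r : Set.Ioi (0 : ℝ), (r : ℝ) ^ (2 * p) * Real.exp (-(r : ℝ) ^ 2 / 2)
          ∂.volumeIoiPow (Module.finrank ℝ E - 1) := by
  calc ∫ x, projNormSq b S x ^ p * Real.exp (-‖x‖ ^ 2 / 2) ∂μ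
      = ∫ x : ({(0)}ᶜ : Set E), projNormSq b S x ^ p * Real.exp (-‖(x : E)‖ ^ 2 / 2)
          ∂(μ.comap (↑)) := by
        rw [integral_subtype_comap (measurableSet_singleton _).compl
          fun x ↦ projNormSq b S x ^ p * Real.exp (-‖x‖ ^ 2 / 2), restrict_compl_singleton]
    _ = ∫ z : Metric.sphere (0 : E) 1 × Set.Ioi (0 : ℝ), projNormSq b S z.1 ^ p *
          ((z.2 : ℝ) ^ (2 * p) * Real.exp (-(z.2 : ℝ) ^ 2 / 2))
          ∂μ.toSphere.prod (.volumeIoiPow (Module.finrank ℝ E - 1)) := by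
        rw [← μ.measurePreserving_homeomorphUnitSphereProd.integral_comp
          (Homeomorph.measurableEmbedding _)]
        congr 1 with x
        have hx : ‖(x : E)‖ ≠ 0 := norm_ne_zero_iff.2 x.2
        simp only [homeomorphUnitSphereProd_apply_fst_coe, homeomorphUnitSphereProd_apply_snd_coe,
          projNormSq_smul]
        rw [mul_pow, ← pow_mul, inv_pow, pow_mul]
        field_simp
    _ = _ := integral_prod_mul (fun u : Metric.sphere (0 : E) 1 ↦ projNormSq b S u ^ p)
        fun r : Set.Ioi (0 : ℝ) ↦ (r : ℝ) ^ (2 * p) * Real.exp (-(r : ℝ) ^ 2 / 2)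

/-- The moment recursion of the Beta distribution for the squared norm of the projection of a
uniform vector on the sphere. -/
lemma toSphere_moment_succ [Nontrivial E] (μ : Measure E) [μ.IsAddHaarMeasure] (p : ℕ) :
    (Module.finrank ℝ E + 2 * p) *
        ∫ u : Metric.sphere (0 : E) 1, projNormSq b S u ^ (p + 1) ∂μ.toSphere
      = (S.card + 2 * p) * ∫ u : Metric.sphere (0 : E) 1, projNormSq b S u ^ p ∂μ.toSphere := by
  -- For the full index set the spherical factor is constant, so the chi-squared recursion isolates
  -- that of the radial integrals, which is then divided out of the recursion for `S`.
  have hR := fun q ↦ integral_projNormSq_pow_eq_mul_toSphere b Finset.univ μ q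
  have hsphere (q : ℕ) : ∫ u : Metric.sphere (0 : E) 1,
      projNormSq b Finset.univ (u : E) ^ q ∂μ.toSphere = μ.toSphere.real Set.univ := by
    simp [projNormSq_univ]
  have hvol : μ.toSphere.real Set.univ ≠ 0 := by
    simp [measureReal_eq_zero_iff, Module.finrank_pos.ne', measure_ball_lt_top.ne,
      (Metric.measure_ball_pos μ 0 one_pos).ne']
  have hrec := integral_projNormSq_pow_succ b Finset.univ μ
  have hS := fun q ↦ integral_projNormSq_pow_eq_mul_toSphere b S μ q
  have hSrec := integral_projNormSq_pow_succ b S μ p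
  have hpos (q : ℕ) : (0 : ℝ) ≠
      ∫ x, projNormSq b Finset.univ x ^ q * Real.exp (-‖x‖ ^ 2 / 2) ∂μ := by
    refine (integral_pos_of_integrable_nonneg_nonzero (x := b (Classical.choice ?_))
      (by fun_prop) (integrable_projNormSq_pow b _ μ q) (fun x ↦ ?_) ?_).ne
    · exact b.toBasis.index_nonempty
    · exact mul_nonneg (pow_nonneg (projNormSq_nonneg b _ x) q) (Real.exp_pos _).le
    · simp [projNormSq_univ]
  simp only [hsphere] at hR
  simp only [hR, mul_left_comm _ (μ.toSphere.real Set.univ), mul_right_inj' hvol] at hrec hpos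
  have hcard : Module.finrank ℝ E = Finset.univ.card (α := ι) :=
    Module.finrank_eq_card_basis b.toBasis
  rw [hS, hS, hrec p] at hSrec
  have h0 := hpos p
  rw [hcard]
  have : (∫ r : Set.Ioi (0 : ℝ), (r : ℝ) ^ (2 * p) * Real.exp (-(r : ℝ) ^ 2 / 2)
          ∂.volumeIoiPow (Module.finrank ℝ E - 1)) ≠ 0 := (mul_ne_zero_iff.1 h0.symm).2
  refine mul_right_cancel₀ this ?_
  linear_combination hSrec

end GaussianMoments

/-! ### Sub-Gaussian concentration for uniform vectors on the sphere. -/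

section Sphere

variable {n : ℕ}

lemma isProbabilityMeasure_uniformSphere (hn : 0 < n) :
    IsProbabilityMeasure (uniformSphere n) := by
  have : Nonempty (Fin n) := ⟨⟨0, hn⟩⟩
  refine ⟨?_⟩
  rw [uniformSphere, Measure.smul_apply, smul_eq_mul]
  refine ENNReal.inv_mul_cancel ?_ (measure_ne_top _ _)
  rw [Ne, Measure.measure_univ_eq_zero]
  exact Measure.toSphere_ne_zero _

variable {ι : Type*} [Fintype ι] (b : OrthonormalBasis ι ℝ (EuclideanSpace ℝ (Fin n)))
  (S : Finset ι)

lemma projNormSq_sphere_mem_Icc (u : Metric.sphere (0 : EuclideanSpace ℝ (Fin n)) 1) :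
    projNormSq b S u ∈ Set.Icc (0 : ℝ) 1 :=
  ⟨projNormSq_nonneg b S u, by simpa using projNormSq_le b S u⟩

lemma uniformSphere_moment_succ (hn : 0 < n) (p : ℕ) :
    ((n : ℝ) / 2 + p) * ∫ u, projNormSq b S u ^ (p + 1) ∂uniformSphere n
      = ((S.card : ℝ) / 2 + p) * ∫ u, projNormSq b S u ^ p ∂uniformSphere n := by
  have : Nonempty (Fin n) := ⟨⟨0, hn⟩⟩
  have h := toSphere_moment_succ b S volume p
  rw [finrank_euclideanSpace_fin] at h
  simp only [uniformSphere, integral_smul_measure, smul_eq_mul]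
  linear_combination ((volume : Measure (EuclideanSpace ℝ (Fin n))).toSphere Set.univ)⁻¹.toReal
    / 2 * h

/-- The Beta moment bound with `α = #S / 2` and `c = n / 2`, after centering. -/
lemma mgf_projNormSq_sub_le_of_nonneg (hn : 0 < n) {s : ℝ} (hs : 0 ≤ s) :
    mgf (fun u : Metric.sphere (0 : EuclideanSpace ℝ (Fin n)) 1 ↦
        projNormSq b S u - S.card / n) (uniformSphere n) s
      ≤ Real.exp (s ^ 2 / (4 * (n + 2))) := by
  have := isProbabilityMeasure_uniformSphere hn
  have hn' : (0 : ℝ) < n := Nat.cast_pos.2 hn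
  have h := mgf_le_of_moments_of_nonneg
    (X := fun u : Metric.sphere (0 : EuclideanSpace ℝ (Fin n)) 1 ↦ projNormSq b S u)
    (by fun_prop) (projNormSq_sphere_mem_Icc b S) (half_pos hn')
    (uniformSphere_moment_succ b S hn) hs
  simp only [sub_eq_add_neg]
  rw [mgf_add_const]
  calc _ ≤ Real.exp (s * ((S.card : ℝ) / 2 / (n / 2)) + s ^ 2 / (8 * (n / 2 + 1)))
        * Real.exp (s * -(S.card / n)) := by gcongr
    _ = _ := by
        rw [← Real.exp_add]
        congr 1
        field_simp
        ring

/-- The squared norm of the projection of a uniform vector on the sphere is sub-Gaussian with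
variance proxy `1 / (2 * (n + 2))`. -/
lemma hasSubgaussianMGF_projNormSq (hn : 0 < n) :
    HasSubgaussianMGF (fun u : Metric.sphere (0 : EuclideanSpace ℝ (Fin n)) 1 ↦
        projNormSq b S u - S.card / n) (1 / (2 * (n + 2))) (uniformSphere n) where
  integrable_exp_mul t := by
    have := isProbabilityMeasure_uniformSphere hn
    have h := integrable_pow_mul_exp_of_mem_Icc (μ := uniformSphere n)
      (X := fun u : Metric.sphere (0 : EuclideanSpace ℝ (Fin n)) 1 ↦ projNormSq b S u)
      (by fun_prop) (projNormSq_sphere_mem_Icc b S) 0 t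
    simp only [pow_zero, one_mul] at h
    refine (h.mul_const (Real.exp (-(t * (S.card / n))))).congr (ae_of_all _ fun u ↦ ?_)
    simp only [← Real.exp_add]
    congr 1
    ring
  mgf_le t := by
    classical
    have hn' : (0 : ℝ) < n := Nat.cast_pos.2 hn
    have hexp : ((1 / (2 * (n + 2)) : NNReal) : ℝ) * t ^ 2 / 2 = t ^ 2 / (4 * (n + 2)) := by
      push_cast
      field_simp
      ring
    rw [hexp]
    rcases le_total 0 t with ht | ht
    · exact mgf_projNormSq_sub_le_of_nonneg b S hn ht
    -- On the sphere the projections onto `S` and `Sᶜ` have squared norms summing to `1`, so the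
    -- centered variables are opposite.
    · have h := mgf_projNormSq_sub_le_of_nonneg b Sᶜ hn (neg_nonneg.2 ht)
      rw [neg_sq] at h
      refine le_of_eq_of_le (integral_congr_ae (ae_of_all _ fun u ↦ ?_)) h
      have hcard : (S.card : ℝ) + Sᶜ.card = n := by
        rw [← Nat.cast_add, Finset.card_add_card_compl, ← Module.finrank_eq_card_basis b.toBasis,
          finrank_euclideanSpace_fin]
      have hsum : projNormSq b S (u : EuclideanSpace ℝ (Fin n)) + projNormSq b Sᶜ u = 1 := by
        rw [projNormSq_add_compl]
        simp
      have hc : (S.card : ℝ) / n + Sᶜ.card / n = 1 := by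
        rw [← add_div, hcard, div_self hn'.ne']
      simp only
      congr 1
      linear_combination t * hsum - t * hc

/-- Variance proxies add under independence, to `m / (2 * (n + 2))`; the factor `2` counts the two
tails. -/
lemma measureReal_abs_sum_projNormSq_gt_le (hn : 0 < n) {m : ℕ} (hm : 0 < m)
    {Ω : Type*} [MeasurableSpace Ω] (P : Measure Ω) [IsProbabilityMeasure P]
    {v : Fin m → Ω → Metric.sphere (0 : EuclideanSpace ℝ (Fin n)) 1}
    (hv_law : ∀ i, HasLaw (v i) (uniformSphere n) P) (hv_indep : iIndepFun v P)
    {t : ℝ} (ht : 0 ≤ t) :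
    P.real {ω | m * t < |∑ i, (projNormSq b S (v i ω) - S.card / n)|}
      ≤ 2 * Real.exp (-(m * (n + 2) * t ^ 2)) := by
  have hm' : (0 : ℝ) < m := Nat.cast_pos.2 hm
  have hX : Measurable fun u : Metric.sphere (0 : EuclideanSpace ℝ (Fin n)) 1 ↦
      projNormSq b S u - S.card / n := by fun_prop
  have hsub (i : Fin m) : HasSubgaussianMGF
      (fun ω ↦ projNormSq b S (v i ω) - S.card / n) (1 / (2 * (n + 2))) P := by
    refine HasSubgaussianMGF.of_map (hv_law i).aemeasurable
      (X := fun u : Metric.sphere (0 : EuclideanSpace ℝ (Fin n)) 1 ↦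
        projNormSq b S u - S.card / n) ?_
    rw [(hv_law i).map_eq]
    exact hasSubgaussianMGF_projNormSq b S hn
  have hindep : iIndepFun (fun i ω ↦ projNormSq b S (v i ω) - (S.card : ℝ) / n) P :=
    hv_indep.comp (fun _ u ↦ projNormSq b S u - (S.card : ℝ) / n) fun _ ↦ hX
  have hsum := HasSubgaussianMGF.sum_of_iIndepFun hindep (s := Finset.univ) fun i _ ↦ hsub i
  have hmt : 0 ≤ m * t := by positivity
  have hval : -(m * t) ^ 2 / (2 * ((∑ _ : Fin m, 1 / (2 * (n + 2)) : NNReal) : ℝ))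
      = -(m * (n + 2) * t ^ 2) := by
    simp only [Finset.sum_const, Finset.card_univ, Fintype.card_fin, nsmul_eq_mul]
    push_cast
    field_simp
  have h1 := hsum.measure_ge_le hmt
  have h2 := hsum.neg.measure_ge_le hmt
  rw [hval] at h1 h2
  calc _ ≤ P.real ({ω | m * t ≤ ∑ i, (projNormSq b S (v i ω) - S.card / n)} ∪
        {ω | m * t ≤ -∑ i, (projNormSq b S (v i ω) - S.card / n)}) := by
        refine measureReal_mono fun ω hω ↦ ?_
        rw [Set.mem_ofPred_eq] at hω
        rcases lt_abs.1 hω with h | h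
        · exact Or.inl h.le
        · exact Or.inr h.le
    _ ≤ _ := measureReal_union_le _ _
    _ ≤ _ := by rw [two_mul]; exact add_le_add h1 h2

end Sphere

/-! ### From spectral measures to projections, and the main theorem. -/

section Cesm

variable {n : ℕ} {A : Matrix (Fin n) (Fin n) ℝ} (hA : A.IsHermitian)

lemma cesm_eq_card (x : ℝ) :
    cesm hA x = ((Finset.univ.filter fun i ↦ hA.eigenvalues i ≤ x).card : ℝ) / n := by
  rw [cesm, ← Finset.mul_sum, Finset.sum_boole]
  ring

lemma weightedCesm_eq_projNormSq (v : EuclideanSpace ℝ (Fin n)) (x : ℝ) :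
    weightedCesm hA v x = projNormSq hA.eigenvectorBasis
      (Finset.univ.filter fun i ↦ hA.eigenvalues i ≤ x) v := by
  have h (i : Fin n) : Matrix.vecMul v.ofLp (hA.eigenvectorUnitary : Matrix (Fin n) (Fin n) ℝ) i
      = inner ℝ (hA.eigenvectorBasis i) v := by
    simp [Matrix.vecMul, PiLp.inner_apply, dotProduct]
  rw [weightedCesm, spectralProjector, matrixFunction, ← Matrix.mulVec_mulVec,
    ← Matrix.mulVec_mulVec, Matrix.dotProduct_mulVec, Matrix.mulVec_transpose]
  simp only [dotProduct, Matrix.mulVec_diagonal, h, projNormSq, Finset.sum_filter]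
  refine Finset.sum_congr rfl fun i _ ↦ ?_
  split_ifs <;> ring

/-- Rounding `x` down to the largest eigenvalue not exceeding it leaves the index set unchanged;
this reduces the supremum to `n` thresholds. -/
lemma filter_eigenvalues_eq_empty_or_exists (x : ℝ) :
    (Finset.univ.filter fun i ↦ hA.eigenvalues i ≤ x) = ∅ ∨
      ∃ j, (Finset.univ.filter fun i ↦ hA.eigenvalues i ≤ x)
        = Finset.univ.filter fun i ↦ hA.eigenvalues i ≤ hA.eigenvalues j := by
  rcases Finset.eq_empty_or_nonempty (Finset.univ.filter fun i ↦ hA.eigenvalues i ≤ x) with h | h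
  · exact Or.inl h
  · obtain ⟨j, hj, hmax⟩ := Finset.exists_max_image _ hA.eigenvalues h
    refine Or.inr ⟨j, Finset.ext fun i ↦ ?_⟩
    simp only [Finset.mem_filter, Finset.mem_univ, true_and] at hj hmax ⊢
    exact ⟨hmax i, fun hi ↦ hi.trans hj⟩

lemma sum_projNormSq_sub_eq {m : ℕ} (hm : 0 < m) (u : Fin m → EuclideanSpace ℝ (Fin n)) (x : ℝ) :
    ∑ i, (projNormSq hA.eigenvectorBasis
        (Finset.univ.filter fun i ↦ hA.eigenvalues i ≤ x) (u i)
        - ((Finset.univ.filter fun i ↦ hA.eigenvalues i ≤ x).card : ℝ) / n)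
      = -(m * (cesm hA x - sampleAverage fun i ↦ weightedCesm hA (u i) x)) := by
  have hm' : (m : ℝ) ≠ 0 := by positivity
  simp only [cesm_eq_card, weightedCesm_eq_projNormSq, sampleAverage, Finset.sum_sub_distrib,
    Finset.sum_const, Finset.card_univ, Fintype.card_fin, nsmul_eq_mul]
  field_simp
  ring

end Cesm

theorem mainTheorem2 {n nv : ℕ} (hn : 0 < n) (hnv : 0 < nv)
    {A : Matrix (Fin n) (Fin n) ℝ} (hA : A.IsHermitian)
    {Ω : Type*} [MeasurableSpace Ω] (P : Measure Ω) [IsProbabilityMeasure P]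
    (v : Fin nv → Ω → Metric.sphere (0 : EuclideanSpace ℝ (Fin n)) 1)
    (hv_law : ∀ i, HasLaw (v i) (uniformSphere n) P)
    (hv_indep : iIndepFun v P) :
    (∀ x t : ℝ, 0 < t →
      P.real {ω | |cesm hA x - sampleAverage (fun i => weightedCesm hA (v i ω) x)| > t}
        ≤ 2 * Real.exp (-((nv : ℝ) * ((n : ℝ) + 2) * t ^ 2))) ∧
    (∀ t : ℝ, 0 < t →
      P.real {ω | ksDist (cesm hA)
          (fun x => sampleAverage (fun i => weightedCesm hA (v i ω) x)) > t}
        ≤ 2 * (n : ℝ) * Real.exp (-((nv : ℝ) * ((n : ℝ) + 2) * t ^ 2))) := by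
  have hnv' : (0 : ℝ) < nv := Nat.cast_pos.2 hnv
  have hpoint (x t : ℝ) (ht : 0 < t) :
      P.real {ω | |cesm hA x - sampleAverage (fun i => weightedCesm hA (v i ω) x)| > t}
        ≤ 2 * Real.exp (-((nv : ℝ) * ((n : ℝ) + 2) * t ^ 2)) := by
    have h := measureReal_abs_sum_projNormSq_gt_le hA.eigenvectorBasis
      (Finset.univ.filter fun i ↦ hA.eigenvalues i ≤ x) hn hnv P hv_law hv_indep ht.le
    simpa only [sum_projNormSq_sub_eq hA hnv (fun i ↦ (v i _ : EuclideanSpace ℝ (Fin n))) x,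
      abs_neg, abs_mul, abs_of_pos hnv', mul_lt_mul_iff_right₀ hnv'] using h
  refine ⟨hpoint, fun t ht ↦ ?_⟩
  calc _ ≤ P.real (⋃ j : Fin n, {ω | |cesm hA (hA.eigenvalues j) - sampleAverage
        (fun i => weightedCesm hA (v i ω) (hA.eigenvalues j))| > t}) := by
        refine measureReal_mono fun ω hω ↦ ?_
        rw [Set.mem_ofPred_eq, gt_iff_lt, ksDist] at hω
        obtain ⟨x, hx⟩ := exists_lt_of_lt_ciSup hω
        rw [Set.mem_iUnion]
        simp only [cesm_eq_card, weightedCesm_eq_projNormSq] at hx ⊢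
        -- Below the whole spectrum both functions vanish, so no extra event enters the union bound.
        rcases filter_eigenvalues_eq_empty_or_exists hA x with h | ⟨j, h⟩
        · simp [h, projNormSq, sampleAverage] at hx
          exact absurd hx ht.le.not_gt
        · rw [h] at hx
          exact ⟨j, by simpa only [Set.mem_ofPred_eq, cesm_eq_card, weightedCesm_eq_projNormSq]
            using hx⟩
    _ ≤ _ := measureReal_iUnion_fintype_le _
    _ ≤ ∑ _ : Fin n, 2 * Real.exp (-((nv : ℝ) * ((n : ℝ) + 2) * t ^ 2)) :=
        Finset.sum_le_sum fun j _ ↦ hpoint _ t ht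
    _ = _ := by
        rw [Finset.sum_const, Finset.card_univ, Fintype.card_fin, nsmul_eq_mul]
        ring
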